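/- Let $p$ be an odd prime. For $s\ge 0$ put $$\bar P_s(x)=\sum_{k=0}^{(p^s-1)/2}\binom{(p^s-1)/2}{k}^2x^k={}_2F_1\Big(\frac{1-p^s}2,\frac{1-p^s}2;1;x\Big),$$ where $(p^s-1)/2$ is the truncation of the $p$-adic expansion of $-\frac12$ to its first $s$ digits, and let $$\mathfrak D=\{x\in\mathbb Z_p : |\bar P_1(x)|_p=1\},\qquad F(x)={}_2F_1\big(\tfrac12,\tfrac12;1;x\big)=\sum_{k\ge0}\binom{-1/2}{k}^2x^k .$$ Then: (i) For every $s\ge1$ the rational function $\bar P_{s+1}(x)/\bar P_s(x^p)$ is regular at every point of $\mathfrak D$. (ii) The sequence $\big(\bar P_{s+1}(x)/\bar P_s(x^p)\big)_{s\ge1}$ converges uniformly on $\mathfrak D$ to a function $f:\mathfrak D\to\mathbb Q_p$. This function is analytic: for every $a\in\mathfrak D$ the disc $\{x\in\mathbb Z_p : |x-a|_p<1\}$ is contained in $\mathfrak D$, and on this disc $f$ is the sum of a convergent power series in $x-a$ with coefficients in $\mathbb Q_p$. (iii) The disc $\{x\in\mathbb Z_p : |x|_p<1\}$ is contained in $\mathfrak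 D$, and on it the power series $F$ converges, $F(x^p)\ne0$, and $f(x)=F(x)/F(x^p)$. (iv) $|f(x)|_p=1$ for all $x\in\mathfrak D$. -/

import Mathlib

namespace PApprox

open Polynomial

noncomputable section

/-- The polynomial `∑_{k=0}^{m} (m choose k)² x^k` over `ℚ_p` with `m = (p^s - 1)/2`; for odd `p`
this is `₂F₁((1 - p^s)/2, (1 - p^s)/2; 1; x)` (see `approxPoly_eval`), and `m` is the truncation
of the `p`-adic expansion of `-1/2` to its first `s` digits (see `half_eq_appr`). -/
def approxPoly (p : ℕ) [Fact p.Prime] (s : ℕ) : ℚ_[p][X] :=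
  ∑ k ∈ Finset.range ((p ^ s - 1) / 2 + 1), C ((((p ^ s - 1) / 2).choose k : ℚ_[p]) ^ 2) * X ^ k

/-- The rational function `approxPoly p (s+1) (x) / approxPoly p s (x^p)` over `ℚ_p`. -/
def approxRatio (p : ℕ) [Fact p.Prime] (s : ℕ) : RatFunc ℚ_[p] :=
  algebraMap ℚ_[p][X] (RatFunc ℚ_[p]) (approxPoly p (s + 1)) /
    algebraMap ℚ_[p][X] (RatFunc ℚ_[p]) (expand ℚ_[p] p (approxPoly p s))

/-- A rational function is regular at `a` if `a` is not a root of its reduced denominator. -/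
def IsRegularAt {K : Type*} [Field K] (r : RatFunc K) (a : K) : Prop :=
  r.denom.eval a ≠ 0

/-- The domain `{x ∈ ℤ_p : |approxPoly p 1 (x)|_p = 1}`, as a subset of `ℚ_p`. -/
def domain (p : ℕ) [Fact p.Prime] : Set ℚ_[p] :=
  {x | ‖x‖ ≤ 1 ∧ ‖(approxPoly p 1).eval x‖ = 1}

/-- The value of `₂F₁(1/2, 1/2; 1; x)` on `ℚ_p`. -/
def F (p : ℕ) [Fact p.Prime] (x : ℚ_[p]) : ℚ_[p] :=
  ₂F₁ (1 / 2 : ℚ_[p]) (1 / 2 : ℚ_[p]) (1 : ℚ_[p]) x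

theorem hyp_coeff_neg_nat (K : Type*) [Field K] [CharZero K] (m k : ℕ) :
    ordinaryHypergeometricCoefficient (-(m : K)) (-(m : K)) 1 k = (m.choose k : K) ^ 2 := by
  have h1 : (ascPochhammer K k).eval (-(m : K)) = (-1) ^ k * (k.factorial * m.choose k : ℕ) := by
    rw [ascPochhammer_eval_neg_eq_descPochhammer, descPochhammer_eval_eq_descFactorial,
      Nat.descFactorial_eq_factorial_mul_choose]
  have h2 : (ascPochhammer K k).eval 1 = (k.factorial : K) := by
    rw [ascPochhammer_eval_one]
  have h3 : (k.factorial : K) ≠ 0 := by exact_mod_cast k.factorial_ne_zero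
  have h4 : ((-1 : K) ^ k) ^ 2 = 1 := by rw [← pow_mul, mul_comm, pow_mul]; simp
  unfold ordinaryHypergeometricCoefficient
  rw [h1, h2]
  push_cast
  field_simp
  rw [h4, one_mul]

theorem approxPoly_eval (p : ℕ) [Fact p.Prime] (hp : p ≠ 2) (s : ℕ) (x : ℚ_[p]) :
    (approxPoly p s).eval x
      = ₂F₁ ((1 - (p : ℚ_[p]) ^ s) / 2) ((1 - (p : ℚ_[p]) ^ s) / 2) (1 : ℚ_[p]) x := by
  have hodd : Odd (p ^ s) := ((Fact.out : p.Prime).odd_of_ne_two hp).pow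
  obtain ⟨m, hm⟩ := hodd
  have hm2 : (p ^ s - 1) / 2 = m := by omega
  have hc : (1 - (p : ℚ_[p]) ^ s) / 2 = -(m : ℚ_[p]) := by
    have : (p : ℚ_[p]) ^ s = 2 * m + 1 := by exact_mod_cast hm
    rw [this]; ring
  rw [hc, ordinaryHypergeometric, ordinaryHypergeometric_sum_eq,
    tsum_eq_sum (s := Finset.range (m + 1))]
  · simp only [approxPoly, hm2, eval_finsetSum, eval_mul, eval_C, eval_pow, eval_X, smul_eq_mul]
    exact Finset.sum_congr rfl fun k _ => by rw [← hyp_coeff_neg_nat]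
  · intro k hk
    have := hyp_coeff_neg_nat ℚ_[p] m k
    rw [Nat.choose_eq_zero_of_lt (by simpa using hk)] at this
    unfold ordinaryHypergeometricCoefficient at this
    rw [this]; simp

theorem half_eq_appr (p : ℕ) [Fact p.Prime] (hp : p ≠ 2) (s : ℕ) (a : ℤ_[p]) (ha : 2 * a = -1) :
    (p ^ s - 1) / 2 = a.appr s := by
  have hodd : Odd (p ^ s) := ((Fact.out : p.Prime).odd_of_ne_two hp).pow
  obtain ⟨m, hm⟩ := hodd
  have hm2 : (p ^ s - 1) / 2 = m := by omega
  have h1 := a.appr_spec s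
  have h2 : ((2 * a.appr s + 1 : ℕ) : ℤ_[p]) ∈ Ideal.span {(p : ℤ_[p]) ^ s} := by
    have := (Ideal.span {(p : ℤ_[p]) ^ s}).mul_mem_left (-2) h1
    convert this using 1
    push_cast
    linear_combination ha
  rw [Ideal.mem_span_singleton] at h2
  have h3 : p ^ s ∣ 2 * a.appr s + 1 := by
    rwa [← Nat.cast_pow, ← Int.cast_natCast, ← Int.cast_natCast (2 * _ + 1), Nat.cast_pow,
      Int.cast_pow, Int.cast_natCast, PadicInt.pow_p_dvd_int_iff, ← Nat.cast_pow,
      Int.natCast_dvd_natCast] at h2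
  have h4 := a.appr_lt s
  obtain ⟨c, hc⟩ := h3
  have : c < 2 := by
    by_contra! h
    have := Nat.mul_le_mul_left (p ^ s) h
    omega
  interval_cases c <;> omega

end

end PApprox

namespace PApprox

open Polynomial

noncomputable section

/-! ### Expansion of digit products along a Frobenius lift -/

section Ghost

variable {A : Type*} [CommRing A]

/-! Write `P_s` for the polynomial in question and `m = (p^s - 1)/2`. Then `P_s` is the coefficient
of `t^m` in `((1 + t)(t + x))^m`. Since all base `p` digits of `m` equal `(p - 1)/2`, this power is
`∏_{i<s} g^(p^i)` with `g = ((1 + t)(t + x))^((p-1)/2)`. Expanding the product along the Frobenius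
lift `x ↦ x^p, t ↦ t^p` gives ghost terms divisible by `p^j` (`pow_dvd_ghostTerm`) and of `t`-degree
less than `p^(j+1)`. Uniqueness of base `p` digits then turns middle coefficients into a recursion
`P_{s+1} = ∑ c_j σ^(j+1)(P_{s-j})` with `p^j ∣ c_j`, where `σ` is `x ↦ x^p` (`intPoly_succ`).

The recursion implies the Dwork congruences `P_{s+2} σ(P_s) ≡ P_{s+1} σ(P_{s+1}) mod p^(s+1)`
(`dwork_congruence`), and modulo `p` it gives `P_{s+1} ≡ P_1 σ(P_s)`, so every `P_s` takes unit
values on the domain.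

In any ring where the denominators become units, consecutive ratios therefore differ by a multiple
of `p^(s+1)`. In `ℤ_p` this gives uniform convergence; in `ℤ_p[[X]]`, after expanding at a point of
the domain, it gives a limiting power series. Near 0, `P_s → F` coefficientwise because `-m → 1/2`.
-/

/-- The product `∏_{i < s} g ^ (p ^ i)`. -/
def digitProd (p : ℕ) (g : A) (s : ℕ) : A :=
  ∏ i ∈ Finset.range s, g ^ p ^ i

/-- The terms of the expansion of `digitProd p g (s + 1)` along the iterates of an endomorphism `φ`,
see `digitProd_succ_eq_sum`. -/
def ghostTerm (φ : A →+* A) (p : ℕ) (g : A) (s : ℕ) : A :=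
  digitProd p g (s + 1) -
    ∑ j : Fin s, ghostTerm φ p g j * (φ ^ ((j : ℕ) + 1)) (digitProd p g (s - j))
decreasing_by exact j.2

theorem digitProd_succ (p : ℕ) (g : A) (s : ℕ) :
    digitProd p g (s + 1) = digitProd p g s * g ^ p ^ s :=
  Finset.prod_range_succ _ _

theorem ghostTerm_eq (φ : A →+* A) (p : ℕ) (g : A) (s : ℕ) :
    ghostTerm φ p g s = digitProd p g (s + 1) -
      ∑ j ∈ Finset.range s, ghostTerm φ p g j * (φ ^ (j + 1)) (digitProd p g (s - j)) := by
  rw [ghostTerm, Finset.sum_range]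

theorem digitProd_succ_eq_sum (φ : A →+* A) (p : ℕ) (g : A) (s : ℕ) :
    digitProd p g (s + 1) = ∑ j ∈ Finset.range (s + 1),
      ghostTerm φ p g j * (φ ^ (j + 1)) (digitProd p g (s - j)) := by
  rw [Finset.sum_range_succ, Nat.sub_self]
  conv_rhs => rw [ghostTerm_eq φ p g s]
  simp [digitProd]

theorem dvd_iterate_sub_pow {φ : A →+* A} {p : ℕ} (h : ∀ a, (p : A) ∣ φ a - a ^ p) (a : A) (j : ℕ) :
    (p : A) ∣ (φ ^ j) a - a ^ p ^ j := by
  induction j with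
  | zero => simp
  | succ j ih =>
    have h1 := map_dvd φ ih
    have h2 := h (a ^ p ^ j)
    rw [map_natCast, map_sub] at h1
    have := dvd_add h1 h2
    rwa [sub_add_sub_cancel, ← pow_mul, ← pow_succ, ← RingHom.comp_apply, ← RingHom.mul_def,
      ← pow_succ'] at this

/-- Comparing the expansions of two successive digit products leaves, for each `j`, the earlier
ghost term times a difference of powers of `φ^(j+1) g` and `g^(p^(j+1))`. These agree modulo `p`,
and each `p`-th power gains one more factor `p`. -/
theorem pow_dvd_ghostTerm {φ : A →+* A} {p : ℕ} (h : ∀ a, (p : A) ∣ φ a - a ^ p) (g : A) (s : ℕ) :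
    (p : A) ^ s ∣ ghostTerm φ p g s := by
  induction s using Nat.strong_induction_on with
  | _ s ih =>
    obtain _ | s := s
    · simp
    rw [ghostTerm_eq, digitProd_succ, digitProd_succ_eq_sum φ, Finset.sum_mul,
      ← Finset.sum_sub_distrib]
    refine Finset.dvd_sum fun j hj => ?_
    have hj : j ≤ s := Nat.lt_succ_iff.mp (Finset.mem_range.mp hj)
    have h1 : (p : A) ^ (s - j + 1) ∣
        (φ ^ (j + 1)) g ^ p ^ (s - j) - (g ^ p ^ (j + 1)) ^ p ^ (s - j) :=
      dvd_sub_pow_of_dvd_sub (dvd_iterate_sub_pow h g (j + 1)) (s - j)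
    rw [← pow_mul, ← pow_add, show j + 1 + (s - j) = s + 1 by omega] at h1
    have h2 := mul_dvd_mul (ih j (by omega)) h1
    rw [← pow_add, show j + (s - j + 1) = s + 1 by omega] at h2
    rw [show s + 1 - j = s - j + 1 by omega, digitProd_succ, map_mul, map_pow]
    have h3 := (h2.mul_right ((φ ^ (j + 1)) (digitProd p g (s - j)))).neg_right
    convert h3 using 1
    ring

end Ghost

/-! ### Dwork congruences from the recursion -/

section Dwork

variable {R : Type*} [CommRing R] [IsDomain R]

/-- A cross-multiplied form of `P_{n+i+1} / P_{n+i} ≡ σ^i(P_{n+1} / P_n)`, obtained by chaining the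
one-step congruences. -/
theorem dwork_telescope {σ : R →+* R} {p : ℕ} (hp : Prime (p : R)) {P : ℕ → R}
    (hP : ∀ n, ¬ (p : R) ∣ σ (P n)) (n i : ℕ)
    (h : ∀ s, s < n + i → (p : R) ^ (s + 1) ∣ P (s + 2) * σ (P s) - P (s + 1) * σ (P (s + 1))) :
    (p : R) ^ (n + 1) ∣
      P (n + i + 1) * (σ ^ i) (P n) - P (n + i) * (σ ^ i) (P (n + 1)) := by
  induction i with
  | zero => simp [mul_comm]
  | succ i ih =>
    have h1 := map_dvd σ (ih fun s hs => h s (by omega))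
    have h2 := (pow_dvd_pow (p : R) (show n + 1 ≤ n + i + 1 by omega)).trans (h (n + i) (by omega))
    simp only [map_pow, map_natCast, map_sub, map_mul, ← RingHom.comp_apply] at h1
    simp only [← RingHom.mul_def, ← pow_succ'] at h1
    -- Both congruences share the factor `σ (P (n + i))`, which is prime to `p` and can be
    -- cancelled.
    refine hp.pow_dvd_of_dvd_mul_left _ (hP (n + i)) ?_
    convert dvd_add (h1.mul_left (P (n + i + 1))) (h2.mul_left ((σ ^ (i + 1)) (P n))) using 1
    simp only [← add_assoc]
    ring

theorem dwork_congruence {σ : R →+* R} {p : ℕ} (hp : Prime (p : R)) {P c : ℕ → R}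
    (hP : ∀ n, ¬ (p : R) ∣ σ (P n)) (hc : ∀ j, (p : R) ^ j ∣ c j)
    (hPc : ∀ s, P (s + 1) = ∑ j ∈ Finset.range (s + 1), c j * (σ ^ (j + 1)) (P (s - j))) (s : ℕ) :
    (p : R) ^ (s + 1) ∣ P (s + 2) * σ (P s) - P (s + 1) * σ (P (s + 1)) := by
  induction s using Nat.strong_induction_on with
  | _ s ih =>
    rw [hPc (s + 1), Finset.sum_range_succ]
    nth_rewrite 1 [hPc s]
    rw [add_mul, Finset.sum_mul, Finset.sum_mul,
      add_sub_right_comm, ← Finset.sum_sub_distrib]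
    -- The unpaired term carries `c (s + 1)`. In the others, `c j` gives `p^j` and telescoping gives
    -- `p^(s+1-j)`, using only congruences of index below `s`.
    refine dvd_add (Finset.dvd_sum fun j hj => ?_) (((hc _).mul_right _).mul_right _)
    have hj : j ≤ s := Nat.lt_succ_iff.mp (Finset.mem_range.mp hj)
    have h1 := map_dvd σ (dwork_telescope hp hP (s - j) j fun t ht => ih t (by omega))
    rw [show s - j + j = s by omega, show s - j + 1 = s + 1 - j by omega] at h1
    have h2 := mul_dvd_mul (hc j) h1
    simp only [map_pow, map_natCast, map_sub, map_mul, ← RingHom.comp_apply] at h2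
    simp only [← RingHom.mul_def, ← pow_succ'] at h2
    rw [← pow_add, show j + (s + 1 - j) = s + 1 by omega] at h2
    convert h2.neg_right using 1
    ring

end Dwork

/-! ### The integral polynomials as middle coefficients -/

section Polynomial

/-- Division with remainder by `q`: only one pair of exponents contributes. -/
theorem coeff_mul_expand {R : Type*} [CommSemiring R] {q : ℕ} (A B : R[X]) (hA : A.natDegree < q)
    {a : ℕ} (ha : a < q) (b : ℕ) :
    (A * expand R q B).coeff (a + q * b) = A.coeff a * B.coeff b := by
  have hq : 0 < q := by omega
  rw [coeff_mul, Finset.sum_eq_single (a, q * b)]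
  · simp [coeff_expand_mul' hq]
  · rintro ⟨i, j⟩ hij hne
    replace hij : i + j = a + q * b := by simpa using hij
    dsimp only
    by_cases hi : i < q
    · rw [coeff_expand hq, if_neg, mul_zero]
      rintro ⟨k, rfl⟩
      have h1 := congrArg (· % q) hij
      simp only [Nat.add_mul_mod_self_left, Nat.mod_eq_of_lt hi, Nat.mod_eq_of_lt ha] at h1
      subst h1
      exact hne (by simpa using hij)
    · rw [coeff_eq_zero_of_natDegree_lt (by omega), zero_mul]
  · simp

/-- The lift `x ↦ x ^ p`, `t ↦ t ^ p` of Frobenius to `ℤ[x][t]`. -/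
def frobLift (p : ℕ) : ℤ[X][X] →+* ℤ[X][X] :=
  (expand ℤ[X] p : ℤ[X][X] →+* ℤ[X][X]).comp (mapRingHom (expand ℤ p : ℤ[X] →+* ℤ[X]))

theorem frobLift_pow_apply (p j : ℕ) (f : ℤ[X][X]) :
    (frobLift p ^ j) f =
      expand ℤ[X] (p ^ j) (f.map ((expand ℤ p : ℤ[X] →+* ℤ[X]) ^ j)) := by
  induction j with
  | zero => rw [pow_zero, pow_zero, pow_zero, expand_one]; exact (Polynomial.map_id).symm
  | succ j ih =>
    rw [pow_succ', RingHom.mul_def, RingHom.comp_apply, ih, frobLift, RingHom.comp_apply,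
      coe_mapRingHom, map_expand, pow_succ' _ j, expand_mul, pow_succ', RingHom.mul_def,
      Polynomial.map_map]
    rfl

theorem dvd_frobLift_sub_pow (p : ℕ) [Fact p.Prime] (f : ℤ[X][X]) :
    (p : ℤ[X][X]) ∣ frobLift p f - f ^ p := by
  let I : Ideal ℤ[X][X] := Ideal.span {(p : ℤ[X][X])}
  have hpI : ((p : ℕ) : ℤ[X][X] ⧸ I) = 0 := by
    rw [← map_natCast (Ideal.Quotient.mk I)]
    exact Ideal.Quotient.eq_zero_iff_mem.mpr (Ideal.mem_span_singleton_self _)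
  have hI : I ≠ ⊤ := by
    intro h
    rw [Ideal.span_singleton_eq_top] at h
    have h1 := h.map (evalRingHom (0 : ℤ[X]))
    have h2 := h1.map (evalRingHom (0 : ℤ))
    simp only [map_natCast] at h2
    have := Int.isUnit_iff.mp h2
    have := (Fact.out : p.Prime).two_le
    omega
  have : Nontrivial (ℤ[X][X] ⧸ I) := Ideal.Quotient.nontrivial_iff.mpr hI
  have : CharP (ℤ[X][X] ⧸ I) p := by
    exact (CharP.charP_iff_prime_eq_zero (R := ℤ[X][X] ⧸ I) (Fact.out : p.Prime)).mpr hpI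
  -- Modulo `p` both sides are ring homomorphisms, so it suffices to compare them on `x` and `t`.
  have key : (Ideal.Quotient.mk I).comp (frobLift p) =
      (frobenius (ℤ[X][X] ⧸ I) p).comp (Ideal.Quotient.mk I) := by
    refine Polynomial.ringHom_ext' (Polynomial.ringHom_ext' (RingHom.ext_int _ _) ?_) ?_
    · simp [frobLift, frobenius_def]
    · simp [frobLift, frobenius_def]
  have h := RingHom.congr_fun key f
  rw [RingHom.comp_apply, RingHom.comp_apply, frobenius_def, ← map_pow, Ideal.Quotient.eq] at h
  exact Ideal.mem_span_singleton.mp h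

/-- The polynomial `∑ (m choose k)² x^k` over `ℤ`, with `m = (p ^ s - 1) / 2`. -/
def intPoly (p s : ℕ) : ℤ[X] :=
  ∑ k ∈ Finset.range ((p ^ s - 1) / 2 + 1), C ((((p ^ s - 1) / 2).choose k : ℤ) ^ 2) * X ^ k

theorem coeff_intPoly (p s k : ℕ) :
    (intPoly p s).coeff k = (((p ^ s - 1) / 2).choose k : ℤ) ^ 2 := by
  simp only [intPoly, finsetSum_coeff, coeff_C_mul_X_pow, Finset.sum_ite_eq, Finset.mem_range]
  split_ifs with h
  · rfl
  · rw [Nat.choose_eq_zero_of_lt (by omega)]; simp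

/-- `((1 + t) (t + x)) ^ m` over `ℤ[x]`. -/
def master (m : ℕ) : ℤ[X][X] := ((X + C 1) * (X + C X)) ^ m

theorem coeff_master (m : ℕ) :
    (master m).coeff m = ∑ k ∈ Finset.range (m + 1), C ((m.choose k : ℤ) ^ 2) * X ^ k := by
  rw [master, mul_pow, coeff_mul, Finset.Nat.sum_antidiagonal_eq_sum_range_succ_mk]
  refine Finset.sum_congr rfl fun k hk => ?_
  have hk : k ≤ m := Nat.lt_succ_iff.mp (Finset.mem_range.mp hk)
  dsimp only
  rw [coeff_X_add_C_pow, coeff_X_add_C_pow, Nat.choose_symm hk, one_pow, one_mul,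
    Nat.sub_sub_self hk, C_pow, map_natCast]
  ring

theorem natDegree_master_le (m : ℕ) : (master m).natDegree ≤ 2 * m := by
  refine natDegree_pow_le.trans ?_
  rw [mul_comm]
  refine Nat.mul_le_mul_right _ (natDegree_mul_le.trans ?_)
  rw [natDegree_X_add_C, natDegree_X_add_C]

variable {p : ℕ}

theorem two_mul_half (hp : Odd p) (s : ℕ) : 2 * ((p ^ s - 1) / 2) + 1 = p ^ s := by
  obtain ⟨m, hm⟩ := hp.pow (n := s)
  omega

theorem half_add (hp : Odd p) (i j : ℕ) :
    (p ^ (i + j) - 1) / 2 = (p ^ i - 1) / 2 + p ^ i * ((p ^ j - 1) / 2) := by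
  have h1 := two_mul_half hp i
  have h2 := two_mul_half hp j
  have h3 := two_mul_half hp (i + j)
  have h4 : p ^ i * (2 * ((p ^ j - 1) / 2) + 1) = p ^ (i + j) := by rw [h2, pow_add]
  have h5 : p ^ i * (2 * ((p ^ j - 1) / 2) + 1) = 2 * (p ^ i * ((p ^ j - 1) / 2)) + p ^ i := by ring
  omega

theorem digitProd_master (hp : Odd p) (s : ℕ) :
    digitProd p (master ((p - 1) / 2)) s = master ((p ^ s - 1) / 2) := by
  induction s with
  | zero => simp [digitProd, master]
  | succ s ih =>
    rw [digitProd_succ, ih, half_add hp s 1, pow_one, master, master, master, ← pow_mul, ← pow_add,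
      mul_comm (p ^ s)]

/-- By induction, every term has degree at most `(p^(j+1) - 1) + p^(j+1) (p^(s-j) - 1) = p^(s+1) -
1`. -/
theorem natDegree_ghostTerm_lt (hp : Odd p) (s : ℕ) :
    (ghostTerm (frobLift p) p (master ((p - 1) / 2)) s).natDegree < p ^ (s + 1) := by
  induction s using Nat.strong_induction_on with
  | _ s ih =>
    have h1 : ∀ s, (digitProd p (master ((p - 1) / 2)) s).natDegree ≤ p ^ s - 1 := fun s => by
      rw [digitProd_master hp]
      have := natDegree_master_le ((p ^ s - 1) / 2)
      omega
    have h0 : ∀ s, 0 < p ^ s := fun s => Nat.pow_pos hp.pos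
    rw [ghostTerm_eq, ← Nat.le_sub_one_iff_lt (h0 _)]
    refine (natDegree_sub_le_of_le (h1 _)
      (natDegree_sum_le_of_forall_le _ _ fun j hj => ?_)).trans (max_self _).le
    have hj : j < s := Finset.mem_range.mp hj
    refine natDegree_mul_le.trans ?_
    rw [frobLift_pow_apply, natDegree_expand]
    have h2 := Nat.mul_le_mul_right (p ^ (j + 1))
      ((natDegree_map_le (f := (expand ℤ p : ℤ[X] →+* ℤ[X]) ^ (j + 1))).trans (h1 (s - j)))
    have h3 := ih j hj
    have h4 : p ^ (s + 1) = p ^ (s - j) * p ^ (j + 1) := by rw [← pow_add]; congr 1; omega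
    rw [Nat.sub_mul, one_mul, ← h4] at h2
    have h5 : p ^ (j + 1) ≤ p ^ (s + 1) := Nat.pow_le_pow_right hp.pos (by omega)
    omega

/-- The middle coefficient of the ghost term. -/
def ghostCoeff (p s : ℕ) : ℤ[X] :=
  (ghostTerm (frobLift p) p (master ((p - 1) / 2)) s).coeff ((p ^ (s + 1) - 1) / 2)

theorem intPoly_succ (hp : Odd p) (s : ℕ) :
    intPoly p (s + 1) = ∑ j ∈ Finset.range (s + 1),
      ghostCoeff p j * ((expand ℤ p : ℤ[X] →+* ℤ[X]) ^ (j + 1)) (intPoly p (s - j)) := by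
  have h := congrArg (fun f : ℤ[X][X] => f.coeff ((p ^ (s + 1) - 1) / 2))
    (digitProd_succ_eq_sum (frobLift p) p (master ((p - 1) / 2)) s)
  simp only [digitProd_master hp, coeff_master, finsetSum_coeff] at h
  rw [intPoly, h]
  refine Finset.sum_congr rfl fun j hj => ?_
  have hj : j ≤ s := Nat.lt_succ_iff.mp (Finset.mem_range.mp hj)
  have hs : s + 1 = (j + 1) + (s - j) := by omega
  rw [hs, half_add hp (j + 1), frobLift_pow_apply, coeff_mul_expand _ _ (natDegree_ghostTerm_lt hp j),
    coeff_map, coeff_master]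
  · rfl
  · have := two_mul_half hp (j + 1)
    omega

theorem pow_dvd_ghostCoeff [Fact p.Prime] (s : ℕ) : (p : ℤ[X]) ^ s ∣ ghostCoeff p s := by
  have h := pow_dvd_ghostTerm (dvd_frobLift_sub_pow p) (master ((p - 1) / 2)) s
  rw [← map_natCast (C : ℤ[X] →+* ℤ[X][X]), ← map_pow, C_dvd_iff_dvd_coeff] at h
  exact h _

/-- The constant term is 1. -/
theorem not_dvd_expand_intPoly [Fact p.Prime] (s : ℕ) :
    ¬ (p : ℤ[X]) ∣ (expand ℤ p : ℤ[X] →+* ℤ[X]) (intPoly p s) := by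
  intro h
  rw [← map_natCast (C : ℤ →+* ℤ[X]), C_dvd_iff_dvd_coeff] at h
  have h0 := h 0
  rw [RingHom.coe_coe, coeff_expand (Fact.out : p.Prime).pos, if_pos (dvd_zero p), Nat.zero_div,
    coeff_intPoly, Nat.choose_zero_right] at h0
  have := (Fact.out : p.Prime).two_le
  have := Int.le_of_dvd (by norm_num) h0
  norm_num at this
  omega

theorem prime_natCast_int_poly [Fact p.Prime] : Prime (p : ℤ[X]) := by
  rw [← map_natCast (C : ℤ →+* ℤ[X]), Polynomial.prime_C_iff]
  exact Nat.prime_iff_prime_int.mp Fact.out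

theorem intPoly_congruence [Fact p.Prime] (hp : Odd p) (s : ℕ) :
    (p : ℤ[X]) ^ (s + 1) ∣ intPoly p (s + 2) * expand ℤ p (intPoly p s) -
      intPoly p (s + 1) * expand ℤ p (intPoly p (s + 1)) :=
  dwork_congruence (σ := (expand ℤ p : ℤ[X] →+* ℤ[X])) prime_natCast_int_poly not_dvd_expand_intPoly
    pow_dvd_ghostCoeff (intPoly_succ hp) s

/-- Modulo `p` only the `j = 0` term of the recursion survives. -/
theorem intPoly_lucas [Fact p.Prime] (hp : Odd p) (s : ℕ) :
    (p : ℤ[X]) ∣ intPoly p (s + 1) - intPoly p 1 * expand ℤ p (intPoly p s) := by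
  have h1 : intPoly p 1 = ghostCoeff p 0 := by
    rw [intPoly_succ hp 0]; simp [intPoly]
  rw [h1, intPoly_succ hp, Finset.sum_range_succ', zero_add, pow_one, Nat.sub_zero, RingHom.coe_coe,
    add_sub_cancel_right]
  exact Finset.dvd_sum fun j _ =>
    ((dvd_pow_self _ j.succ_ne_zero).trans (pow_dvd_ghostCoeff (j + 1))).mul_right _

end Polynomial

/-! ### Power series with coefficients of norm at most 1 -/

open Filter Topology

section NormedRing

variable {K : Type*} [NormedCommRing K] [NormOneClass K]

theorem norm_mul_pow_le {c : ℕ → K} (hc : ∀ k, ‖c k‖ ≤ 1) (u : K) (k : ℕ) :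
    ‖c k * u ^ k‖ ≤ ‖u‖ ^ k :=
  (norm_mul_le _ _).trans <| by
    simpa using mul_le_mul (hc k) (norm_pow_le u k) (norm_nonneg _) zero_le_one

theorem summable_norm_mul_pow {c : ℕ → K} (hc : ∀ k, ‖c k‖ ≤ 1) {u : K} (hu : ‖u‖ < 1) :
    Summable fun k => ‖c k * u ^ k‖ :=
  .of_nonneg_of_le (fun _ => norm_nonneg _) (norm_mul_pow_le hc u)
    (summable_geometric_of_lt_one (norm_nonneg _) hu)

theorem tendsto_tsum_mul_pow [CompleteSpace K] {c : ℕ → ℕ → K} {l : ℕ → K}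
    (hc : ∀ s k, ‖c s k‖ ≤ 1) (hl : ∀ k, Tendsto (fun s => c s k) atTop (𝓝 (l k)))
    {u : K} (hu : ‖u‖ < 1) :
    Tendsto (fun s => ∑' k, c s k * u ^ k) atTop (𝓝 (∑' k, l k * u ^ k)) :=
  tendsto_tsum_of_dominated_convergence (summable_geometric_of_lt_one (norm_nonneg u) hu)
    (fun k => (hl k).mul_const _) (Eventually.of_forall fun s k => norm_mul_pow_le (hc s) u k)

end NormedRing

theorem hasFPowerSeriesOnBall_ofScalars {K : Type*} [NontriviallyNormedField K] [CompleteSpace K]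
    {c : ℕ → K} (hc : ∀ k, ‖c k‖ ≤ 1) {f : K → K} {a : K}
    (hf : ∀ u, ‖u‖ < 1 → f (a + u) = ∑' k, c k * u ^ k) :
    HasFPowerSeriesOnBall f (FormalMultilinearSeries.ofScalars K c) a 1 where
  r_le := by
    refine FormalMultilinearSeries.le_radius_of_bound (r := 1) _ 1 fun n => ?_
    simpa [FormalMultilinearSeries.ofScalars_norm] using hc n
  r_pos := one_pos
  hasSum {y} hy := by
    have hy : ‖y‖ < 1 := by
      rwa [← ENNReal.ofReal_one, Metric.eball_ofReal, mem_ball_zero_iff] at hy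
    simp only [FormalMultilinearSeries.ofScalars_apply_eq, smul_eq_mul]
    rw [hf y hy]
    exact (summable_norm_mul_pow hc hy).of_norm.hasSum

/-! ### Ratios over rings where the denominators are units -/

section Ratio

variable {S : Type*} [CommRing S]

/-- The image of `intPoly p (s + 1) (x) / intPoly p s (x ^ p)` under `Φ`. -/
def ratio (p : ℕ) (Φ : ℤ[X] →+* S) (s : ℕ) : S :=
  Φ (intPoly p (s + 1)) * Ring.inverse (Φ (expand ℤ p (intPoly p s)))

theorem map_ratio {p : ℕ} {K : Type*} [Field K] {Φ : ℤ[X] →+* S} (χ : S →+* K) {s : ℕ}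
    (h : IsUnit (Φ (expand ℤ p (intPoly p s)))) :
    χ (ratio p Φ s) = χ (Φ (intPoly p (s + 1))) / χ (Φ (expand ℤ p (intPoly p s))) := by
  rw [eq_div_iff (h.map χ).ne_zero, ← map_mul, ratio, mul_assoc, Ring.inverse_mul_cancel _ h, mul_one]

end Ratio

variable {p : ℕ} [Fact p.Prime]

/-- Evaluation of a power series over `ℤ_p` at a point of the open unit disc of `ℚ_p`. -/
def powerSeriesEval (u : ℚ_[p]) (hu : ‖u‖ < 1) : PowerSeries ℤ_[p] →+* ℚ_[p] where
  toFun φ := ∑' k, ((PowerSeries.coeff k φ : ℤ_[p]) : ℚ_[p]) * u ^ k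
  map_zero' := by simp
  map_one' := by
    rw [tsum_eq_single 0]
    · simp
    · intro k hk; simp [PowerSeries.coeff_one, hk]
  map_add' φ ψ := by
    have h (φ : PowerSeries ℤ_[p]) :=
      (summable_norm_mul_pow (fun k => (PowerSeries.coeff k φ).2) hu).of_norm
    rw [← (h φ).tsum_add (h ψ)]
    simp [add_mul]
  map_mul' φ ψ := by
    have h (φ : PowerSeries ℤ_[p]) := summable_norm_mul_pow (fun k => (PowerSeries.coeff k φ).2) hu
    rw [tsum_mul_tsum_eq_tsum_sum_antidiagonal_of_summable_norm (h φ) (h ψ)]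
    refine tsum_congr fun n => ?_
    rw [PowerSeries.coeff_mul, PadicInt.coe_sum, Finset.sum_mul]
    refine Finset.sum_congr rfl fun ij hij => ?_
    have hn : ij.1 + ij.2 = n := by simpa using hij
    rw [← hn, pow_add]
    push_cast
    ring

theorem powerSeriesEval_apply (u : ℚ_[p]) (hu : ‖u‖ < 1) (φ : PowerSeries ℤ_[p]) :
    powerSeriesEval u hu φ = ∑' k, ((PowerSeries.coeff k φ : ℤ_[p]) : ℚ_[p]) * u ^ k := rfl

/-- Substitution of `z + X` into an integral polynomial. -/
def shiftHom (z : ℤ_[p]) : ℤ[X] →+* PowerSeries ℤ_[p] :=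
  (aeval (PowerSeries.C z + PowerSeries.X) : ℤ[X] →ₐ[ℤ] PowerSeries ℤ_[p])

theorem constantCoeff_shiftHom (z : ℤ_[p]) (f : ℤ[X]) :
    PowerSeries.constantCoeff (shiftHom z f) = aeval z f := by
  have : PowerSeries.constantCoeff.comp (shiftHom z) = (aeval z : ℤ[X] →ₐ[ℤ] ℤ_[p]) :=
    Polynomial.ringHom_ext' (RingHom.ext_int _ _) (by simp [shiftHom])
  exact RingHom.congr_fun this f

theorem powerSeriesEval_shiftHom (z : ℤ_[p]) (u : ℚ_[p]) (hu : ‖u‖ < 1) (f : ℤ[X]) :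
    powerSeriesEval u hu (shiftHom z f) = aeval (z + u : ℚ_[p]) f := by
  have hC : powerSeriesEval u hu (PowerSeries.C z) = z := by
    rw [powerSeriesEval_apply, tsum_eq_single 0]
    · simp
    · intro k hk; simp [PowerSeries.coeff_C, hk]
  have hX : powerSeriesEval u hu PowerSeries.X = u := by
    rw [powerSeriesEval_apply, tsum_eq_single 1]
    · simp
    · intro k hk; simp [PowerSeries.coeff_X, hk]
  have : (powerSeriesEval u hu).comp (shiftHom z) =
      (aeval (z + u : ℚ_[p]) : ℤ[X] →ₐ[ℤ] ℚ_[p]) :=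
    Polynomial.ringHom_ext' (RingHom.ext_int _ _) (by simp [shiftHom, hC, hX])
  exact RingHom.congr_fun this f

theorem pow_dvd_ratio_sub {S : Type*} [CommRing S] (hp : Odd p) {Φ : ℤ[X] →+* S}
    (h : ∀ s, IsUnit (Φ (expand ℤ p (intPoly p s)))) (s : ℕ) :
    (p : S) ^ (s + 1) ∣ ratio p Φ (s + 1) - ratio p Φ s := by
  have h1 := map_dvd Φ (intPoly_congruence hp s)
  simp only [map_pow, map_natCast, map_sub, map_mul] at h1
  have e0 := Ring.mul_inverse_cancel _ (h s)
  have e1 := Ring.mul_inverse_cancel _ (h (s + 1))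
  convert (h1.mul_right (Ring.inverse (Φ (expand ℤ p (intPoly p s))))).mul_right
    (Ring.inverse (Φ (expand ℤ p (intPoly p (s + 1))))) using 1
  simp only [ratio]
  linear_combination
    (-Φ (intPoly p (s + 2)) * Ring.inverse (Φ (expand ℤ p (intPoly p (s + 1))))) * e0 +
    (Φ (intPoly p (s + 1)) * Ring.inverse (Φ (expand ℤ p (intPoly p s)))) * e1

theorem exists_limit_of_pow_dvd {a : ℕ → ℤ_[p]} (h : ∀ s, (p : ℤ_[p]) ^ (s + 1) ∣ a (s + 1) - a s) :
    ∃ l, Tendsto a atTop (𝓝 l) ∧ ∀ s, dist (a s) l ≤ (p : ℝ)⁻¹ ^ s / (1 - (p : ℝ)⁻¹) := by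
  have hp1 : (p : ℝ)⁻¹ < 1 := inv_lt_one_of_one_lt₀ (by exact_mod_cast (Fact.out : p.Prime).one_lt)
  have hd : ∀ s, dist (a s) (a (s + 1)) ≤ 1 * (p : ℝ)⁻¹ ^ s := fun s => by
    obtain ⟨c, hc⟩ := h s
    rw [dist_comm, dist_eq_norm, hc, pow_succ, mul_assoc, norm_mul, norm_pow, PadicInt.norm_p, one_mul]
    exact mul_le_of_le_one_right (by positivity) (PadicInt.norm_le_one _)
  obtain ⟨l, hl⟩ := cauchySeq_tendsto_of_complete (cauchySeq_of_le_geometric _ _ hp1 hd)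
  exact ⟨l, hl, fun s => by simpa using dist_le_of_le_geometric_of_tendsto _ _ hp1 hd hl s⟩

/-! ### Reduction modulo `p` and the domain -/

theorem toZMod_eq_zero_iff (z : ℤ_[p]) : PadicInt.toZMod z = 0 ↔ ‖z‖ < 1 := by
  rw [← RingHom.mem_ker, PadicInt.ker_toZMod, IsLocalRing.mem_maximalIdeal, PadicInt.mem_nonunits]

theorem toZMod_aeval (z : ℤ_[p]) (f : ℤ[X]) :
    PadicInt.toZMod (aeval z f) = aeval (PadicInt.toZMod z) f :=
  (aeval_algHom_apply (PadicInt.toZMod (p := p)).toIntAlgHom z f).symm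

theorem toZMod_aeval_expand (z : ℤ_[p]) (f : ℤ[X]) :
    PadicInt.toZMod (aeval z (expand ℤ p f)) = PadicInt.toZMod (aeval z f) := by
  rw [expand_aeval, toZMod_aeval, toZMod_aeval, map_pow, ZMod.pow_card]

/-- Iterates the Lucas congruence, with `z^p = z` in `ZMod p`. -/
theorem toZMod_aeval_intPoly (hp : Odd p) (z : ℤ_[p]) (s : ℕ) :
    PadicInt.toZMod (aeval z (intPoly p s)) = PadicInt.toZMod (aeval z (intPoly p 1)) ^ s := by
  induction s with
  | zero => simp [intPoly]
  | succ s ih =>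
    have h := map_dvd (PadicInt.toZMod (p := p)) (map_dvd (aeval z) (intPoly_lucas hp s))
    simp only [map_natCast, CharP.cast_eq_zero, zero_dvd_iff, map_sub, map_mul, sub_eq_zero,
      toZMod_aeval_expand] at h
    rw [h, ih, pow_succ']

theorem approxPoly_eq_map (s : ℕ) : approxPoly p s = (intPoly p s).map (Int.castRingHom ℚ_[p]) := by
  simp [approxPoly, intPoly, Polynomial.map_sum]

theorem eval_approxPoly (s : ℕ) (x : ℚ_[p]) : (approxPoly p s).eval x = aeval x (intPoly p s) := by
  rw [approxPoly_eq_map, eval_map, aeval_def]; rfl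

theorem coe_aeval (z : ℤ_[p]) (f : ℤ[X]) : ((aeval z f : ℤ_[p]) : ℚ_[p]) = aeval (z : ℚ_[p]) f :=
  (aeval_algHom_apply (PadicInt.Coe.ringHom (p := p)).toIntAlgHom z f).symm

theorem coe_mem_domain_iff (z : ℤ_[p]) :
    (z : ℚ_[p]) ∈ domain p ↔ PadicInt.toZMod (aeval z (intPoly p 1)) ≠ 0 := by
  rw [ne_eq, toZMod_eq_zero_iff, not_lt, domain, Set.mem_ofPred_eq, eval_approxPoly, ← coe_aeval,
    ← PadicInt.norm_def]
  exact ⟨fun h => h.2.ge, fun h => ⟨z.2, (PadicInt.norm_le_one _).antisymm h⟩⟩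

theorem isUnit_aeval_of_mem_domain (hp : Odd p) {z : ℤ_[p]} (hz : (z : ℚ_[p]) ∈ domain p) (s : ℕ) :
    IsUnit (aeval z (intPoly p s)) ∧ IsUnit (aeval z (expand ℤ p (intPoly p s))) := by
  have hu : ∀ w : ℤ_[p], PadicInt.toZMod w ≠ 0 → IsUnit w := fun w hw => by
    rw [ne_eq, toZMod_eq_zero_iff, not_lt] at hw
    exact PadicInt.isUnit_iff.mpr ((PadicInt.norm_le_one _).antisymm hw)
  have h := pow_ne_zero s ((coe_mem_domain_iff z).mp hz)
  rw [← toZMod_aeval_intPoly hp] at h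
  exact ⟨hu _ h, hu _ (by rwa [toZMod_aeval_expand])⟩

theorem exists_coe_of_mem_domain {x : ℚ_[p]} (hx : x ∈ domain p) : ∃ z : ℤ_[p], (z : ℚ_[p]) = x :=
  ⟨⟨x, hx.1⟩, rfl⟩

theorem add_mem_domain {x u : ℚ_[p]} (hx : x ∈ domain p) (hu : ‖u‖ < 1) : x + u ∈ domain p := by
  obtain ⟨z, rfl⟩ := exists_coe_of_mem_domain hx
  obtain ⟨v, rfl⟩ : ∃ v : ℤ_[p], (v : ℚ_[p]) = u := ⟨⟨u, hu.le⟩, rfl⟩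
  rw [← PadicInt.coe_add, coe_mem_domain_iff, toZMod_aeval, map_add,
    (toZMod_eq_zero_iff v).mpr hu, add_zero, ← toZMod_aeval]
  exact (coe_mem_domain_iff z).mp hx

theorem ball_subset_domain {a : ℚ_[p]} (ha : a ∈ domain p) : Metric.ball a 1 ⊆ domain p := by
  intro x hx
  rw [← add_sub_cancel a x]
  exact add_mem_domain ha (by rwa [← dist_eq_norm])

theorem zero_mem_domain : (0 : ℚ_[p]) ∈ domain p := by
  refine ⟨by simp, ?_⟩
  rw [eval_approxPoly, ← coeff_zero_eq_aeval_zero', coeff_intPoly]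
  simp

theorem norm_aeval_of_mem_domain (hp : Odd p) {x : ℚ_[p]} (hx : x ∈ domain p) (s : ℕ) :
    ‖aeval x (intPoly p s)‖ = 1 ∧ ‖aeval x (expand ℤ p (intPoly p s))‖ = 1 := by
  obtain ⟨z, rfl⟩ := exists_coe_of_mem_domain hx
  have h := isUnit_aeval_of_mem_domain hp hx s
  rw [← coe_aeval, ← coe_aeval, ← PadicInt.norm_def, ← PadicInt.norm_def]
  exact ⟨PadicInt.isUnit_iff.mp h.1, PadicInt.isUnit_iff.mp h.2⟩

theorem eval_expand_approxPoly (s : ℕ) (x : ℚ_[p]) :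
    (expand ℚ_[p] p (approxPoly p s)).eval x = aeval x (expand ℤ p (intPoly p s)) := by
  rw [expand_eval, expand_aeval, eval_approxPoly]

theorem isRegularAt_approxRatio (hp : Odd p) (s : ℕ) {x : ℚ_[p]} (hx : x ∈ domain p) :
    IsRegularAt (approxRatio p s) x := by
  intro h
  have h1 := eval_dvd (x := x)
    (RatFunc.denom_div_dvd (approxPoly p (s + 1)) (expand ℚ_[p] p (approxPoly p s)))
  rw [approxRatio] at h
  rw [h, zero_dvd_iff, eval_expand_approxPoly] at h1
  have h2 := (norm_aeval_of_mem_domain hp hx s).2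
  rw [h1, norm_zero] at h2
  exact zero_ne_one h2

theorem eval_approxRatio (hp : Odd p) (s : ℕ) {x : ℚ_[p]} (hx : x ∈ domain p) :
    (approxRatio p s).eval (RingHom.id ℚ_[p]) x =
      aeval x (intPoly p (s + 1)) / aeval x (expand ℤ p (intPoly p s)) := by
  have h2 : aeval x (expand ℤ p (intPoly p s)) ≠ 0 := by
    rw [← norm_ne_zero_iff, (norm_aeval_of_mem_domain hp hx s).2]; exact one_ne_zero
  have hq : expand ℚ_[p] p (approxPoly p s) ≠ 0 := by
    intro h
    rw [← eval_expand_approxPoly, h, eval_zero] at h2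
    exact h2 rfl
  have h1 := congrArg (eval x) ((RatFunc.num_mul_eq_mul_denom_iff (x := approxRatio p s)
    (p := approxPoly p (s + 1)) hq).mpr rfl)
  rw [eval_mul, eval_mul, eval_expand_approxPoly, eval_approxPoly] at h1
  rw [RatFunc.eval, eval₂_id, eval₂_id, div_eq_div_iff (isRegularAt_approxRatio hp s hx) h2, h1]

theorem coe_ratio_eq_eval_approxRatio (hp : Odd p) (s : ℕ) {z : ℤ_[p]} (hz : (z : ℚ_[p]) ∈ domain p) :
    ((ratio p (aeval z : ℤ[X] →ₐ[ℤ] ℤ_[p]).toRingHom s : ℤ_[p]) : ℚ_[p]) =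
      (approxRatio p s).eval (RingHom.id ℚ_[p]) z := by
  rw [eval_approxRatio hp s hz, ← coe_aeval, ← coe_aeval]
  exact map_ratio PadicInt.Coe.ringHom (isUnit_aeval_of_mem_domain hp hz s).2

theorem isUnit_shiftHom (hp : Odd p) {z : ℤ_[p]} (hz : (z : ℚ_[p]) ∈ domain p) (s : ℕ) :
    IsUnit (shiftHom z (expand ℤ p (intPoly p s))) := by
  rw [PowerSeries.isUnit_iff_constantCoeff, constantCoeff_shiftHom]
  exact (isUnit_aeval_of_mem_domain hp hz s).2

theorem powerSeriesEval_ratio (hp : Odd p) (s : ℕ) {z : ℤ_[p]} (hz : (z : ℚ_[p]) ∈ domain p)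
    {u : ℚ_[p]} (hu : ‖u‖ < 1) :
    powerSeriesEval u hu (ratio p (shiftHom z) s) =
      (approxRatio p s).eval (RingHom.id ℚ_[p]) (z + u) := by
  rw [eval_approxRatio hp s (add_mem_domain hz hu), map_ratio _ (isUnit_shiftHom hp hz s),
    powerSeriesEval_shiftHom, powerSeriesEval_shiftHom]

/-! ### The limit function and its analyticity -/

/-- The pointwise limit of the functions `approxRatio p s`. -/
def limitRatio (p : ℕ) [Fact p.Prime] (x : ℚ_[p]) : ℚ_[p] :=
  limUnder atTop fun s => (approxRatio p s).eval (RingHom.id ℚ_[p]) x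

theorem tendsto_limitRatio (hp : Odd p) {x : ℚ_[p]} (hx : x ∈ domain p) :
    Tendsto (fun s => (approxRatio p s).eval (RingHom.id ℚ_[p]) x) atTop (𝓝 (limitRatio p x)) ∧
    ∀ s, dist (limitRatio p x) ((approxRatio p s).eval (RingHom.id ℚ_[p]) x) ≤
      (p : ℝ)⁻¹ ^ s / (1 - (p : ℝ)⁻¹) := by
  obtain ⟨z, rfl⟩ := exists_coe_of_mem_domain hx
  obtain ⟨l, hl, hd⟩ := exists_limit_of_pow_dvd
    (pow_dvd_ratio_sub hp (Φ := (aeval z : ℤ[X] →ₐ[ℤ] ℤ_[p]).toRingHom)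
      fun s => (isUnit_aeval_of_mem_domain hp hx s).2)
  have h1 : Tendsto (fun s => (approxRatio p s).eval (RingHom.id ℚ_[p]) (z : ℚ_[p])) atTop
      (𝓝 (l : ℚ_[p])) := by
    simp_rw [← coe_ratio_eq_eval_approxRatio hp _ hx]
    exact (continuous_subtype_val.tendsto l).comp hl
  have h2 : limitRatio p (z : ℚ_[p]) = l := h1.limUnder_eq
  rw [h2]
  refine ⟨h1, fun s => ?_⟩
  rw [dist_comm, ← coe_ratio_eq_eval_approxRatio hp _ hx]
  exact hd s

theorem tendstoUniformlyOn_limitRatio (hp : Odd p) :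
    TendstoUniformlyOn (fun (s : ℕ) (x : ℚ_[p]) => (approxRatio p s).eval (RingHom.id ℚ_[p]) x)
      (limitRatio p) atTop (domain p) := by
  rw [Metric.tendstoUniformlyOn_iff]
  intro ε hε
  have hp1 : (p : ℝ)⁻¹ < 1 := inv_lt_one_of_one_lt₀ (by exact_mod_cast (Fact.out : p.Prime).one_lt)
  have h := (tendsto_pow_atTop_nhds_zero_of_lt_one (by positivity) hp1).div_const (1 - (p : ℝ)⁻¹)
  rw [zero_div] at h
  filter_upwards [h.eventually_lt_const hε] with s hs x hx
  exact ((tendsto_limitRatio hp hx).2 s).trans_lt hs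

theorem exists_hasFPowerSeriesOnBall_limitRatio (hp : Odd p) {a : ℚ_[p]} (ha : a ∈ domain p) :
    ∃ φ : FormalMultilinearSeries ℚ_[p] ℚ_[p] ℚ_[p],
      HasFPowerSeriesOnBall (limitRatio p) φ a 1 := by
  obtain ⟨z, rfl⟩ := exists_coe_of_mem_domain ha
  have h (k : ℕ) := exists_limit_of_pow_dvd
    (a := fun s => PowerSeries.coeff k (ratio p (shiftHom z) s)) fun s => by
      have h := pow_dvd_ratio_sub hp (isUnit_shiftHom hp ha) s
      rw [← map_natCast PowerSeries.C, ← map_pow] at h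
      obtain ⟨ψ, hψ⟩ := h
      rw [← map_sub, hψ, PowerSeries.coeff_C_mul]
      exact dvd_mul_right _ _
  choose l hl _ using h
  refine ⟨_, hasFPowerSeriesOnBall_ofScalars (c := fun k => (l k : ℚ_[p])) (fun k => (l k).2)
    fun u hu => ?_⟩
  -- The coefficientwise limit sums to the pointwise limit by dominated convergence, with bound
  -- `‖u‖^k`.
  refine tendsto_nhds_unique (tendsto_limitRatio hp (add_mem_domain ha hu)).1 ?_
  simp_rw [← powerSeriesEval_ratio hp _ ha hu, powerSeriesEval_apply]
  exact tendsto_tsum_mul_pow (fun s k => (PowerSeries.coeff k (ratio p (shiftHom z) s)).2)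
    (fun k => (continuous_subtype_val.tendsto (l k)).comp (hl k)) hu

theorem norm_limitRatio (hp : Odd p) {x : ℚ_[p]} (hx : x ∈ domain p) : ‖limitRatio p x‖ = 1 := by
  refine tendsto_nhds_unique (tendsto_limitRatio hp hx).1.norm ?_
  simp_rw [eval_approxRatio hp _ hx, norm_div, (norm_aeval_of_mem_domain hp hx _).1,
    (norm_aeval_of_mem_domain hp hx _).2, div_one]
  exact tendsto_const_nhds

/-! ### Comparison with the hypergeometric series near 0 -/

theorem tendsto_choose_sq (hp : Odd p) (k : ℕ) :
    Tendsto (fun s => ((((p ^ s - 1) / 2).choose k : ℤ) ^ 2 : ℚ_[p])) atTop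
      (𝓝 (ordinaryHypergeometricCoefficient (1 / 2 : ℚ_[p]) (1 / 2) 1 k)) := by
  have h1 : Tendsto (fun s : ℕ => -(((p ^ s - 1) / 2 : ℕ) : ℚ_[p])) atTop (𝓝 (1 / 2)) := by
    have h2 := ((tendsto_pow_atTop_nhds_zero_of_norm_lt_one
      (Padic.norm_p_lt_one (p := p))).const_sub 1).div_const 2
    rw [sub_zero] at h2
    refine h2.congr fun s => ?_
    have h3 : 2 * (((p ^ s - 1) / 2 : ℕ) : ℚ_[p]) + 1 = (p : ℚ_[p]) ^ s := by
      exact_mod_cast two_mul_half hp s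
    rw [← h3]
    ring
  have hc : Continuous fun a : ℚ_[p] => ordinaryHypergeometricCoefficient a a 1 k := by
    unfold ordinaryHypergeometricCoefficient
    fun_prop
  refine ((hc.tendsto _).comp h1).congr fun s => ?_
  simpa using hyp_coeff_neg_nat ℚ_[p] ((p ^ s - 1) / 2) k

/-- The coefficient is a `p`-adic limit of integers. -/
theorem norm_hypergeometricCoefficient_le (hp : Odd p) (k : ℕ) :
    ‖ordinaryHypergeometricCoefficient (1 / 2 : ℚ_[p]) (1 / 2) 1 k‖ ≤ 1 := by
  refine le_of_tendsto (tendsto_choose_sq hp k).norm (Eventually.of_forall fun s => ?_)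
  rw [norm_pow]
  exact pow_le_one₀ (norm_nonneg _) (Padic.norm_int_le_one _)

theorem F_eq_tsum (x : ℚ_[p]) :
    F p x = ∑' k, ordinaryHypergeometricCoefficient (1 / 2 : ℚ_[p]) (1 / 2) 1 k * x ^ k :=
  ordinaryHypergeometric_sum_eq _ _ _ _

theorem hasFPowerSeriesOnBall_F (hp : Odd p) :
    HasFPowerSeriesOnBall (F p)
      (ordinaryHypergeometricSeries ℚ_[p] (1 / 2 : ℚ_[p]) (1 / 2 : ℚ_[p]) (1 : ℚ_[p])) 0 1 :=
  hasFPowerSeriesOnBall_ofScalars (norm_hypergeometricCoefficient_le hp) fun u _ => by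
    rw [zero_add, F_eq_tsum]

theorem aeval_intPoly_eq_tsum (s : ℕ) (x : ℚ_[p]) :
    aeval x (intPoly p s) = ∑' k, ((((p ^ s - 1) / 2).choose k : ℤ) ^ 2 : ℚ_[p]) * x ^ k := by
  rw [tsum_eq_sum (s := Finset.range ((p ^ s - 1) / 2 + 1))]
  · simp [intPoly]
  · intro k hk
    rw [Nat.choose_eq_zero_of_lt (by simpa using hk)]
    simp

theorem tendsto_aeval_intPoly (hp : Odd p) {x : ℚ_[p]} (hx : ‖x‖ < 1) :
    Tendsto (fun s => aeval x (intPoly p s)) atTop (𝓝 (F p x)) := by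
  simp_rw [aeval_intPoly_eq_tsum, F_eq_tsum]
  refine tendsto_tsum_mul_pow (fun s k => ?_) (tendsto_choose_sq hp) hx
  rw [norm_pow]
  exact pow_le_one₀ (norm_nonneg _) (Padic.norm_int_le_one _)

/-- A limit of values of norm 1 has norm 1. -/
theorem F_ne_zero (hp : Odd p) {x : ℚ_[p]} (hx : ‖x‖ < 1) : F p x ≠ 0 := by
  have hd : x ∈ domain p := by simpa using add_mem_domain zero_mem_domain hx
  have h := (tendsto_aeval_intPoly hp hx).norm
  simp_rw [(norm_aeval_of_mem_domain hp hd _).1] at h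
  rw [← norm_ne_zero_iff, ← tendsto_nhds_unique tendsto_const_nhds h]
  exact one_ne_zero

theorem limitRatio_eq_div (hp : Odd p) {x : ℚ_[p]} (hx : ‖x‖ < 1) :
    F p (x ^ p) ≠ 0 ∧ limitRatio p x = F p x / F p (x ^ p) := by
  have hd : x ∈ domain p := by simpa using add_mem_domain zero_mem_domain hx
  have hxp : ‖x ^ p‖ < 1 := by
    rw [norm_pow]
    exact pow_lt_one₀ (norm_nonneg _) hx (Fact.out : p.Prime).ne_zero
  refine ⟨F_ne_zero hp hxp, tendsto_nhds_unique (tendsto_limitRatio hp hd).1 ?_⟩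
  simp_rw [eval_approxRatio hp _ hd, expand_aeval]
  exact ((tendsto_aeval_intPoly hp hx).comp (tendsto_add_atTop_nat 1)).div
    (tendsto_aeval_intPoly hp hxp) (F_ne_zero hp hxp)

end

end PApprox

theorem mainTheorem7 (p : ℕ) [Fact p.Prime] (hp : p ≠ 2) :
    -- each ratio is regular on the domain
    (∀ s : ℕ, 1 ≤ s → ∀ x ∈ PApprox.domain p, PApprox.IsRegularAt (PApprox.approxRatio p s) x) ∧
    -- the disc `|x| < 1` lies in the domain, and `F` is given there by its convergent series
    Metric.ball (0 : ℚ_[p]) 1 ⊆ PApprox.domain p ∧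
    HasFPowerSeriesOnBall (PApprox.F p)
      (ordinaryHypergeometricSeries ℚ_[p] (1 / 2 : ℚ_[p]) (1 / 2 : ℚ_[p]) (1 : ℚ_[p])) 0 1 ∧
    ∃ f : ℚ_[p] → ℚ_[p],
      -- uniform convergence of the ratios to `f`
      TendstoUniformlyOn (fun (s : ℕ) (x : ℚ_[p]) =>
        (PApprox.approxRatio p s).eval (RingHom.id ℚ_[p]) x) f Filter.atTop (PApprox.domain p) ∧
      -- `f` is analytic on each residue disc `|x - a| < 1` contained in the domain
      (∀ a ∈ PApprox.domain p, Metric.ball a 1 ⊆ PApprox.domain p ∧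
        ∃ φ : FormalMultilinearSeries ℚ_[p] ℚ_[p] ℚ_[p], HasFPowerSeriesOnBall f φ a 1) ∧
      -- on the disc `|x| < 1` the limit is `F(x) / F(x^p)`
      (∀ x ∈ Metric.ball (0 : ℚ_[p]) 1,
        PApprox.F p (x ^ p) ≠ 0 ∧ f x = PApprox.F p x / PApprox.F p (x ^ p)) ∧
      (∀ x ∈ PApprox.domain p, ‖f x‖ = 1) := by
  have hodd : Odd p := (Fact.out : p.Prime).odd_of_ne_two hp
  refine ⟨fun s _ x hx => PApprox.isRegularAt_approxRatio hodd s hx,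
    PApprox.ball_subset_domain PApprox.zero_mem_domain, PApprox.hasFPowerSeriesOnBall_F hodd,
    PApprox.limitRatio p, PApprox.tendstoUniformlyOn_limitRatio hodd,
    fun a ha => ⟨PApprox.ball_subset_domain ha,
      PApprox.exists_hasFPowerSeriesOnBall_limitRatio hodd ha⟩,
    fun x hx => PApprox.limitRatio_eq_div hodd (mem_ball_zero_iff.mp hx),
    fun x hx => PApprox.norm_limitRatio hodd hx⟩
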